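/- Let $N\ge 1$ be an integer, $s\in(0,1)$, $T>0$ and $S_T:=\mathbb R^N\times(0,T]$. Let $\mathcal L^s(\mathbb R^N)$ be the space of measurable $f:\mathbb R^N\to\mathbb R$ with $\|f\|_{1,s}:=\int_{\mathbb R^N}\frac{|f(x)|}{1+|x|^{N+2s}}\,dx<\infty$, and write $$(-\Delta)^s f(x)=C_{N,s}\lim_{\varepsilon\to0^+}\int_{\{|x-y|\ge\varepsilon\}}\frac{f(x)-f(y)}{|x-y|^{N+2s}}\,dy,\qquad C_{N,s}=\frac{2^{2s-1}\,2s\,\Gamma\left(\frac{N+2s}{2}\right)}{\pi^{N/2}\,\Gamma(1-s)},$$ whenever this limit exists and is finite. Assume $(H_0)$: $\rho\in C(\mathbb R^N)$ and there are $\alpha\ge0$ and $C_0>0$ such that $\rho(x)\ge C_0(1+|x|^2)^{-\alpha/2}$ for all $x\in\mathbb R^N$; and suppose that $\alpha<2s$. Let $u$ be a solution of the Cauchy problem $$\rho\,u_t-\Delta u+(-\Delta)^s u=0\ \text{ in } S_T,\qquad u=0\ \text{ in }\mathbb R^N\times\{0\},$$ in the following sense: $u\in C^2(\mathbb R^N\times[0,T])$;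 $u\in L^1\big((0,T),\mathcal L^s(\mathbb R^N)\big)$; $u(\cdot,t)\in\mathcal L^s(\mathbb R^N)$ for each $t\in(0,T]$; for every $(x,t)\in S_T$ the limit defining $(-\Delta)^s u(\cdot,t)(x)$ exists and is finite and the equation holds at $(x,t)$ (with the one-sided time derivative at $t=T$); and $u(x,0)=0$ for all $x\in\mathbb R^N$. If $$|u(x,t)|\le C(1+|x|^2)^{\theta/2}\quad\text{for all }(x,t)\in S_T$$ for some $C>0$ and some $0\le\theta<2s-\alpha$, then $u\equiv0$ in $S_T$. -/

import Mathlib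

open MeasureTheory Filter Topology Set

noncomputable section

/-- The weighted seminorm `∫ |f(x)| / (1 + |x|^(N+2s)) dx`, with values in `[0, ∞]`. -/
def lsNorm {N : ℕ} (s : ℝ) (f : EuclideanSpace ℝ (Fin N) → ℝ) : ENNReal :=
  ∫⁻ x, ENNReal.ofReal (|f x| / (1 + ‖x‖ ^ ((N : ℝ) + 2 * s)))

/-- The space `𝓛^s(ℝ^N)` of (measurable) functions with finite weighted integral. -/
def MemLs {N : ℕ} (s : ℝ) (f : EuclideanSpace ℝ (Fin N) → ℝ) : Prop :=
  AEStronglyMeasurable f volume ∧ lsNorm s f < ⊤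

/-- The normalization constant
`C_{N,s} = 2^(2s-1) · 2s · Γ((N+2s)/2) / (π^(N/2) · Γ(1-s))`. -/
def fracLapConst (N : ℕ) (s : ℝ) : ℝ :=
  (2 : ℝ) ^ (2 * s - 1) * (2 * s) * Real.Gamma (((N : ℝ) + 2 * s) / 2) /
    (Real.pi ^ ((N : ℝ) / 2) * Real.Gamma (1 - s))

/-- The truncated singular integral
`C_{N,s} ∫_{|x-y| ≥ ε} (f(x) - f(y)) / |x-y|^(N+2s) dy`. For `ε > 0` and `f ∈ 𝓛^s(ℝ^N)`
the integrand is integrable. -/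
def fracLapTrunc {N : ℕ} (s : ℝ) (f : EuclideanSpace ℝ (Fin N) → ℝ)
    (x : EuclideanSpace ℝ (Fin N)) (ε : ℝ) : ℝ :=
  fracLapConst N s *
    ∫ y in {y | ε ≤ ‖x - y‖}, (f x - f y) / ‖x - y‖ ^ ((N : ℝ) + 2 * s)

/-- `(-Δ)^s f (x)` exists as a principal value and equals `L`. -/
def HasFracLaplacianAt {N : ℕ} (s : ℝ) (f : EuclideanSpace ℝ (Fin N) → ℝ) (L : ℝ)
    (x : EuclideanSpace ℝ (Fin N)) : Prop :=
  Tendsto (fun ε : ℝ => fracLapTrunc s f x ε) (𝓝[>] 0) (𝓝 L)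

/-- Assumption `(H₀)` on the coefficient `ρ`, with exponent `α`. -/
structure AssumptionH0 {N : ℕ} (ρ : EuclideanSpace ℝ (Fin N) → ℝ) (α : ℝ) : Prop where
  continuous : Continuous ρ
  alpha_nonneg : 0 ≤ α
  lower_bound : ∃ C₀ : ℝ, 0 < C₀ ∧ ∀ x, C₀ * (1 + ‖x‖ ^ 2) ^ (-(α / 2)) ≤ ρ x

/-- `u` (with `u x t` the value at the point `x` and the time `t`) is a solution of
`ρ u_t - Δu + (-Δ)^s u = 0` in `S_T = ℝ^N × (0, T]`. The derivatives at `t = T` are one-sided. -/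
structure IsSolutionEquation {N : ℕ} (s T : ℝ) (ρ : EuclideanSpace ℝ (Fin N) → ℝ)
    (u : EuclideanSpace ℝ (Fin N) → ℝ → ℝ) : Prop where
  contDiffOn : ContDiffOn ℝ 2 (Function.uncurry u) (univ ×ˢ Ioc 0 T)
  memLs : ∀ t ∈ Ioc 0 T, MemLs s (fun y => u y t)
  equation : ∀ x, ∀ t ∈ Ioc 0 T, ∃ L : ℝ, HasFracLaplacianAt s (fun y => u y t) L x ∧
    ρ x * derivWithin (u x) (Ioc 0 T) t - Laplacian.laplacian (fun y => u y t) x + L = 0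

/-- `u` is a solution of the Cauchy problem for `ρ u_t - Δu + (-Δ)^s u = 0` in `S_T` with zero
initial data. The first two fields say `u ∈ C²(ℝ^N × [0, T])` (so that `u` is jointly measurable
there) and `u ∈ L¹((0, T); 𝓛^s(ℝ^N))`. -/
structure IsSolutionCauchyProblem {N : ℕ} (s T : ℝ) (ρ : EuclideanSpace ℝ (Fin N) → ℝ)
    (u : EuclideanSpace ℝ (Fin N) → ℝ → ℝ) : Prop where
  contDiffOn_closure : ContDiffOn ℝ 2 (Function.uncurry u) (univ ×ˢ Icc 0 T)
  integrable_time : ∫⁻ t in Ioo 0 T, lsNorm s (fun y => u y t) < ⊤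
  solution : IsSolutionEquation s T ρ u
  initial : ∀ x, u x 0 = 0

end

/-!
Uniqueness follows from a maximum principle with the barrier `exp (κ t) (1 + |x|²)^p`, where
`max (θ, α) < 2 p < 2 s`. The second differences of `(1 + |x|²)^p` in direction `z` are at most
`2 min (|z|², |z|^(2p))` uniformly in `x`. The growth condition makes a positive supremum of `u`
minus a multiple of the barrier attained. At such a maximum the second differences of `u` are at
most those of the barrier, which bounds `Δu` and `-(-Δ)^s u` there by a constant times `exp (κ t)`,
while `ρ u_t` is at least `κ` times such a constant because `ρ (1 + |x|²)^p` is bounded below. For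
large `κ` this contradicts the equation, so `u ≤ 0`, and the same applies to `-u`.
-/

open Asymptotics

section SecondDifferences

variable {E : Type*} [NormedAddCommGroup E]

lemma rpow_add_le_rpow_add_min {a b p : ℝ} (ha : 1 ≤ a) (hb : 0 ≤ b) (hp₀ : 0 ≤ p) (hp₁ : p ≤ 1) :
    (a + b) ^ p ≤ a ^ p + min b (b ^ p) := by
  have ha₀ : 0 < a := by linarith
  rw [← min_add_add_left]
  refine le_min ?_ (Real.rpow_add_le_add_rpow ha₀.le hb hp₀ hp₁)
  have hbernoulli : (1 + b / a) ^ p ≤ 1 + b / a :=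
    Real.rpow_le_self_of_one_le (by linarith [div_nonneg hb ha₀.le]) hp₁
  calc (a + b) ^ p = a ^ p * (1 + b / a) ^ p := by
        rw [← Real.mul_rpow ha₀.le (by positivity)]
        congr 1
        field_simp
    _ ≤ a ^ p * (1 + b / a) := by gcongr
    _ = a ^ p + a ^ p * (b / a) := by ring
    _ ≤ a ^ p + a * (b / a) := by
        gcongr
        exact Real.rpow_le_self_of_one_le ha hp₁
    _ = a ^ p + b := by field_simp

lemma second_difference_rpow_one_add_norm_sq_le [InnerProductSpace ℝ E] {p : ℝ} (hp₀ : 0 ≤ p)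
    (hp₁ : p ≤ 1) (x z : E) :
    (1 + ‖x + z‖ ^ 2) ^ p + (1 + ‖x - z‖ ^ 2) ^ p - 2 * (1 + ‖x‖ ^ 2) ^ p
      ≤ 2 * min (‖z‖ ^ (2 : ℝ)) (‖z‖ ^ (2 * p)) := by
  have hconcave : (1 + ‖x + z‖ ^ 2) ^ p + (1 + ‖x - z‖ ^ 2) ^ p
      ≤ 2 * (1 + ‖x‖ ^ 2 + ‖z‖ ^ 2) ^ p := by
    have hjensen := (Real.concaveOn_rpow hp₀ hp₁).2
      (show 0 ≤ 1 + ‖x + z‖ ^ 2 by positivity) (show 0 ≤ 1 + ‖x - z‖ ^ 2 by positivity)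
      one_half_pos.le one_half_pos.le (add_halves 1)
    have hmid : (1 / 2 : ℝ) * (1 + ‖x + z‖ ^ 2) + 1 / 2 * (1 + ‖x - z‖ ^ 2)
        = 1 + ‖x‖ ^ 2 + ‖z‖ ^ 2 := by
      linarith [parallelogram_law_with_norm ℝ x z]
    simp only [smul_eq_mul, hmid] at hjensen
    linarith
  have hsplit := rpow_add_le_rpow_add_min (by linarith [sq_nonneg ‖x‖] : 1 ≤ 1 + ‖x‖ ^ 2)
    (sq_nonneg ‖z‖) hp₀ hp₁
  rw [← Real.rpow_two ‖z‖, ← Real.rpow_mul (norm_nonneg z), Real.rpow_two] at hsplit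
  rw [Real.rpow_two]
  linarith

lemma iteratedDeriv_two_le_of_second_difference_le {φ : ℝ → ℝ} (hφ : ContDiff ℝ 2 φ) {c : ℝ}
    (h : ∀ r, φ r + φ (-r) - 2 * φ 0 ≤ c * r ^ 2) : iteratedDeriv 2 φ 0 ≤ c := by
  have htaylor : (fun r => φ r - (φ 0 + iteratedDeriv 1 φ 0 * r + iteratedDeriv 2 φ 0 / 2 * r ^ 2))
      =o[𝓝 0] fun r => r ^ 2 := by
    refine (taylor_isLittleO_univ hφ).congr (fun r => ?_) fun r => by simp
    simp only [taylorWithinEval_succ, taylor_within_zero_eval, iteratedDerivWithin_univ,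
      smul_eq_mul, Nat.factorial_zero, Nat.factorial_one, CharP.cast_eq_zero, Nat.cast_one,
      sub_zero]
    ring
  have hsymm : (fun r => φ r + φ (-r) - 2 * φ 0 - iteratedDeriv 2 φ 0 * r ^ 2)
      =o[𝓝 0] fun r => r ^ 2 := by
    have hneg := htaylor.comp_tendsto (k := fun r : ℝ => -r) (by simpa using tendsto_neg (0 : ℝ))
    refine (htaylor.add (hneg.trans_eventuallyEq ?_)).congr_left fun r => ?_
    · exact .of_forall fun r => by simp
    · simp only [Function.comp_apply]
      ring
  have hlim : Tendsto (fun r => (φ r + φ (-r) - 2 * φ 0) / r ^ 2) (𝓝[≠] 0)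
      (𝓝 (iteratedDeriv 2 φ 0)) := by
    have h0 := (hsymm.tendsto_div_nhds_zero.mono_left
      (nhdsWithin_le_nhds (s := {0}ᶜ))).add_const (iteratedDeriv 2 φ 0)
    rw [zero_add] at h0
    refine h0.congr' (eventually_mem_nhdsWithin.mono fun r hr => ?_)
    have : r ≠ 0 := hr
    field_simp
    ring
  refine le_of_tendsto hlim (eventually_mem_nhdsWithin.mono fun r hr => ?_)
  have : r ≠ 0 := hr
  exact (div_le_iff₀ (by positivity)).2 (h r)

lemma iteratedDeriv_line_eq_iteratedFDeriv [NormedSpace ℝ E] {f : E → ℝ} {n : ℕ}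
    (hf : ContDiff ℝ n f) (x v : E) :
    iteratedDeriv n (fun r : ℝ => f (x + r • v)) 0 = iteratedFDeriv ℝ n f x fun _ => v := by
  have hcomp := (ContinuousLinearMap.toSpanSingleton ℝ v).iteratedFDeriv_comp_right
    (f := fun y => f (x + y)) (by fun_prop) (0 : ℝ) (i := n) le_rfl
  rw [iteratedFDeriv_comp_add_left] at hcomp
  simpa [iteratedDeriv_eq_iteratedFDeriv, Function.comp_def] using
    congrArg (fun M => M fun _ => (1 : ℝ)) hcomp

lemma laplacian_le_of_second_difference_le [InnerProductSpace ℝ E] [FiniteDimensional ℝ E]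
    {f : E → ℝ} (hf : ContDiff ℝ 2 f) {c : ℝ} {x : E}
    (h : ∀ z, f (x + z) + f (x - z) - 2 * f x ≤ c * ‖z‖ ^ 2) :
    Laplacian.laplacian f x ≤ Module.finrank ℝ E * c := by
  set e := stdOrthonormalBasis ℝ E
  have hdir : ∀ i, iteratedFDeriv ℝ 2 f x ![e i, e i] ≤ c := fun i => by
    have hpair : ![e i, e i] = fun _ => e i := funext (Fin.forall_fin_two.2 ⟨rfl, rfl⟩)
    rw [hpair, ← iteratedDeriv_line_eq_iteratedFDeriv (by exact_mod_cast hf)]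
    refine iteratedDeriv_two_le_of_second_difference_le (by fun_prop) fun r => ?_
    simpa [norm_smul, e.norm_eq_one, sub_eq_add_neg] using h (r • e i)
  rw [InnerProductSpace.laplacian_eq_iteratedFDeriv_stdOrthonormalBasis]
  simpa using Finset.sum_le_card_nsmul Finset.univ _ c fun i _ => hdir i

end SecondDifferences

section FractionalLaplacian

lemma integrableOn_Ioi_min_rpow {a b : ℝ} (ha : -1 < a) (hb : b < -1) :
    IntegrableOn (fun r : ℝ => min (r ^ a) (r ^ b)) (Ioi 0) := by
  have hmeas : Measurable fun r : ℝ => min (r ^ a) (r ^ b) := by fun_prop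
  rw [← Ioc_union_Ioi_eq_Ioi zero_le_one]
  refine IntegrableOn.union ?_ ?_
  · have hnear : IntegrableOn (fun r : ℝ => r ^ a) (Ioc 0 1) :=
      (intervalIntegrable_iff_integrableOn_Ioc_of_le zero_le_one).1
        (intervalIntegral.intervalIntegrable_rpow' ha)
    refine hnear.mono' hmeas.aestronglyMeasurable
      (ae_restrict_of_forall_mem measurableSet_Ioc fun r hr => ?_)
    have hr₀ : 0 < r := hr.1
    rw [Real.norm_of_nonneg (by positivity)]
    exact min_le_left _ _
  · refine (integrableOn_Ioi_rpow_of_lt hb one_pos).mono' hmeas.aestronglyMeasurable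
      (ae_restrict_of_forall_mem measurableSet_Ioi fun r hr => ?_)
    have hr₀ : 0 < r := one_pos.trans hr
    rw [Real.norm_of_nonneg (by positivity)]
    exact min_le_right _ _

lemma integrable_min_rpow_norm_div {E : Type*} [NormedAddCommGroup E] [NormedSpace ℝ E]
    [FiniteDimensional ℝ E] [MeasurableSpace E] [BorelSpace E] [Nontrivial E]
    (μ : Measure E) [μ.IsAddHaarMeasure] {a b σ : ℝ} (ha : σ < a) (hb : b < σ) :
    Integrable (fun z : E => min (‖z‖ ^ a) (‖z‖ ^ b) / ‖z‖ ^ (Module.finrank ℝ E + σ)) μ := by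
  set d := Module.finrank ℝ E
  have hd : 1 ≤ d := Module.finrank_pos
  have hpolar : ∀ r ∈ Ioi (0 : ℝ), min (r ^ (a - σ - 1)) (r ^ (b - σ - 1))
      = r ^ (d - 1) • (min (r ^ a) (r ^ b) / r ^ (d + σ)) := by
    intro r (hr : 0 < r)
    have hsub : ∀ q : ℝ, r ^ (q - σ - 1) = r ^ q * (r ^ (d - 1) / r ^ (d + σ)) := by
      intro q
      rw [← Real.rpow_natCast r (d - 1), ← Real.rpow_sub hr, ← Real.rpow_add hr]
      congr 1
      push_cast [hd]
      ring
    rw [hsub, hsub, ← min_mul_of_nonneg _ _ (by positivity), smul_eq_mul]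
    ring
  rw [integrable_fun_norm_addHaar μ (f := fun r : ℝ => min (r ^ a) (r ^ b) / r ^ (d + σ))]
  exact (integrableOn_Ioi_min_rpow (by linarith) (by linarith)).congr_fun hpolar measurableSet_Ioi

lemma integral_le_integral_of_add_neg_le {G : Type*} [AddGroup G] [MeasurableSpace G]
    [MeasurableNeg G] {μ : Measure G} [μ.IsNegInvariant] {g h : G → ℝ} (hh : Integrable h μ)
    (hh₀ : ∀ z, 0 ≤ h z) (hgh : ∀ z, g z + g (-z) ≤ 2 * h z) : ∫ z, g z ∂μ ≤ ∫ z, h z ∂μ := by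
  by_cases hg : Integrable g μ
  · have hsum : ∫ z, (g z + g (-z)) ∂μ ≤ ∫ z, 2 * h z ∂μ :=
      integral_mono (hg.add hg.comp_neg) (hh.const_mul 2) hgh
    rw [integral_add hg hg.comp_neg, integral_neg_eq_self g μ, integral_const_mul] at hsum
    linarith
  · -- A non-integrable `g` has integral `0` by convention, and `0 ≤ ∫ h`.
    rw [integral_undef hg]
    exact integral_nonneg hh₀

variable {N : ℕ} {s : ℝ} {f : EuclideanSpace ℝ (Fin N) → ℝ} {L : ℝ} {x : EuclideanSpace ℝ (Fin N)}

lemma fracLapConst_nonneg (N : ℕ) (hs₀ : 0 < s) (hs₁ : s < 1) : 0 ≤ fracLapConst N s := by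
  have hGamma : 0 < Real.Gamma (1 - s) := Real.Gamma_pos_of_pos (by linarith)
  exact div_nonneg (by positivity) (mul_nonneg (by positivity) hGamma.le)

lemma fracLapTrunc_eq_neg_integral_indicator (ε : ℝ) :
    fracLapTrunc s f x ε = -(fracLapConst N s *
      ∫ z, {z | ε ≤ ‖z‖}.indicator (fun z => (f (x - z) - f x) / ‖z‖ ^ (N + 2 * s)) z) := by
  have hmeas : MeasurableSet {y | ε ≤ ‖x - y‖} := measurableSet_le measurable_const (by fun_prop)
  rw [fracLapTrunc, ← mul_neg, ← integral_neg, ← integral_indicator hmeas,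
    ← integral_sub_left_eq_self _ volume x]
  congr 2 with y
  simp only [indicator, mem_ofPred_eq, sub_sub_cancel]
  split_ifs
  · ring
  · simp

lemma HasFracLaplacianAt.ge_of_second_difference_le (hs₀ : 0 < s) (hs₁ : s < 1)
    (hL : HasFracLaplacianAt s f L x) {m : EuclideanSpace ℝ (Fin N) → ℝ} (hm₀ : ∀ z, 0 ≤ m z)
    (hm : Integrable fun z => m z / ‖z‖ ^ (N + 2 * s))
    (h : ∀ z, f (x + z) + f (x - z) - 2 * f x ≤ 2 * m z) :
    -(fracLapConst N s * ∫ z, m z / ‖z‖ ^ (N + 2 * s)) ≤ L := by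
  refine ge_of_tendsto hL (.of_forall fun ε => ?_)
  rw [fracLapTrunc_eq_neg_integral_indicator]
  refine neg_le_neg (mul_le_mul_of_nonneg_left ?_ (fracLapConst_nonneg N hs₀ hs₁))
  have hquot : ∀ z, 0 ≤ m z / ‖z‖ ^ (N + 2 * s) := fun z =>
    div_nonneg (hm₀ z) (by positivity)
  refine integral_le_integral_of_add_neg_le hm hquot fun z => ?_
  by_cases hz : ε ≤ ‖z‖
  · simp only [indicator, mem_ofPred_eq, norm_neg, hz, if_true, sub_neg_eq_add]
    rw [← add_div, ← mul_div_assoc]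
    gcongr
    linarith [h z]
  · simp only [indicator, mem_ofPred_eq, norm_neg, hz, if_false]
    linarith [hquot z]

lemma HasFracLaplacianAt.neg (h : HasFracLaplacianAt s f L x) :
    HasFracLaplacianAt s (fun y => -f y) (-L) x := by
  refine Tendsto.congr (fun ε => ?_) (Tendsto.neg h)
  rw [fracLapTrunc, fracLapTrunc, ← mul_neg, ← integral_neg]
  congr 2 with y
  ring

end FractionalLaplacian

section Barrier

variable {E : Type*} [NormedAddCommGroup E]

/-- The barrier `exp (κ t) (1 + |x|²)^p` of the maximum principle. -/
noncomputable def barrier (p κ : ℝ) (x : E) (t : ℝ) : ℝ :=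
  Real.exp (κ * t) * (1 + ‖x‖ ^ 2) ^ p

/-- A bound, uniform in the base point, for `-(-Δ)^s` of `x ↦ (1 + |x|²)^p` when `0 ≤ p < s`: the
integral of the bound `min (|z|², |z|^(2p))` on half its second differences against the kernel of
the fractional Laplacian. -/
noncomputable def barrierConst (N : ℕ) (s p : ℝ) : ℝ :=
  fracLapConst N s *
    ∫ z : EuclideanSpace ℝ (Fin N), min (‖z‖ ^ (2 : ℝ)) (‖z‖ ^ (2 * p)) / ‖z‖ ^ (N + 2 * s)

lemma barrierConst_nonneg (N : ℕ) {s : ℝ} (p : ℝ) (hs₀ : 0 < s) (hs₁ : s < 1) :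
    0 ≤ barrierConst N s p :=
  mul_nonneg (fracLapConst_nonneg N hs₀ hs₁) (integral_nonneg fun z => by
    simp only [Pi.zero_apply]
    positivity)

lemma barrier_pos (p κ : ℝ) (x : E) (t : ℝ) : 0 < barrier p κ x t := by
  unfold barrier
  positivity

lemma continuous_barrier (p κ : ℝ) : Continuous fun q : E × ℝ => barrier p κ q.1 q.2 := by
  unfold barrier
  refine .mul (by fun_prop) (.rpow_const (by fun_prop) fun q => Or.inl ?_)
  positivity

lemma hasDerivAt_barrier (p κ : ℝ) (x : E) (t : ℝ) :
    HasDerivAt (barrier p κ x) (κ * barrier p κ x t) t := by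
  refine ((((hasDerivAt_id t).const_mul κ).exp).mul_const _).congr_deriv ?_
  simp only [barrier, id]
  ring

lemma isLittleO_rpow_one_add_norm_sq_cocompact [ProperSpace E] {p q : ℝ} (hqp : q < p) :
    (fun x : E => (1 + ‖x‖ ^ 2) ^ q) =o[cocompact E] fun x => (1 + ‖x‖ ^ 2) ^ p := by
  have hbase : Tendsto (fun x : E => 1 + ‖x‖ ^ 2) (cocompact E) atTop :=
    tendsto_atTop_add_const_left _ _
      ((tendsto_pow_atTop two_ne_zero).comp tendsto_norm_cocompact_atTop)
  have hquot : Tendsto (fun x : E => (1 + ‖x‖ ^ 2) ^ (-(p - q))) (cocompact E) (𝓝 0) :=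
    (tendsto_rpow_neg_atTop (sub_pos.2 hqp)).comp hbase
  refine (isLittleO_iff_tendsto fun x hx => absurd hx (by positivity)).2 (hquot.congr fun x => ?_)
  rw [neg_sub, Real.rpow_sub (by positivity)]

lemma eventually_growth_le_barrier [ProperSpace E] {p q κ ε : ℝ} (C : ℝ) (hqp : q < p)
    (hκ : 0 ≤ κ) (hε : 0 < ε) :
    ∀ᶠ x : E in cocompact E, ∀ t, 0 ≤ t → C * (1 + ‖x‖ ^ 2) ^ q ≤ ε * barrier p κ x t := by
  filter_upwards [((isLittleO_rpow_one_add_norm_sq_cocompact hqp).const_mul_left C).def hε]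
    with x hx t ht
  rw [Real.norm_of_nonneg (by positivity : 0 ≤ (1 + ‖x‖ ^ 2) ^ p)] at hx
  refine (le_abs_self _).trans (hx.trans ?_)
  gcongr
  exact le_mul_of_one_le_left (by positivity) (Real.one_le_exp (mul_nonneg hκ ht))

lemma second_difference_le_of_forall_sub_barrier_le [InnerProductSpace ℝ E] {f : E → ℝ}
    {p κ t ε : ℝ} {x : E} (hp₀ : 0 ≤ p) (hp₁ : p ≤ 1) (hε : 0 ≤ ε)
    (hmax : ∀ y, f y - ε * barrier p κ y t ≤ f x - ε * barrier p κ x t) (z : E) :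
    f (x + z) + f (x - z) - 2 * f x
      ≤ 2 * (ε * Real.exp (κ * t) * min (‖z‖ ^ (2 : ℝ)) (‖z‖ ^ (2 * p))) := by
  have hbarrier := mul_le_mul_of_nonneg_left
    (second_difference_rpow_one_add_norm_sq_le hp₀ hp₁ x z)
    (show 0 ≤ ε * Real.exp (κ * t) by positivity)
  have hplus := hmax (x + z)
  have hminus := hmax (x - z)
  simp only [barrier] at hplus hminus
  linarith

end Barrier

section MaximumPrinciple

lemma tendsto_fst_cocompact_inf_principal {X Y : Type*} [TopologicalSpace X] [TopologicalSpace Y]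
    {K : Set Y} (hK : IsCompact K) :
    Tendsto Prod.fst (cocompact (X × Y) ⊓ 𝓟 (univ ×ˢ K)) (cocompact X) := by
  intro S hS
  obtain ⟨A, hA, hAS⟩ := mem_cocompact.1 hS
  refine mem_inf_principal.2 (mem_cocompact.2 ⟨A ×ˢ K, hA.prod hK, ?_⟩)
  exact fun q hq hqK => hAS fun hqA => hq ⟨hqA, hqK.2⟩

lemma hasDerivWithinAt_Iio_le_of_eventually_sub_le {φ ψ : ℝ → ℝ} {φ' ψ' t : ℝ}
    (hφ : HasDerivWithinAt φ φ' (Iio t) t) (hψ : HasDerivWithinAt ψ ψ' (Iio t) t)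
    (hmax : ∀ᶠ r in 𝓝[<] t, φ r - ψ r ≤ φ t - ψ t) : ψ' ≤ φ' := by
  have hslope := (hasDerivWithinAt_iff_tendsto_slope' self_notMem_Iio).1 (hφ.sub hψ)
  refine sub_nonneg.1 (ge_of_tendsto hslope ?_)
  filter_upwards [hmax, self_mem_nhdsWithin] with r hr hrt
  rw [slope_def_field]
  exact div_nonneg_of_nonpos (sub_nonpos.2 hr) (sub_nonpos.2 (le_of_lt hrt))

/-- A classical subsolution of the Cauchy problem: `ρ u_t - Δu + (-Δ)^s u ≤ 0` in `ℝ^N × (0, T]`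
and `u ≤ 0` initially, for `u` continuous up to `t = 0`, twice continuously differentiable in space
and differentiable in time. The time derivative at `t = T` is one-sided. -/
structure IsSubsolution {N : ℕ} (s T : ℝ) (ρ : EuclideanSpace ℝ (Fin N) → ℝ)
    (u : EuclideanSpace ℝ (Fin N) → ℝ → ℝ) : Prop where
  continuousOn : ContinuousOn (Function.uncurry u) (univ ×ˢ Icc 0 T)
  contDiff_space : ∀ t ∈ Ioc 0 T, ContDiff ℝ 2 fun y => u y t
  differentiableOn_time : ∀ x, DifferentiableOn ℝ (u x) (Ioc 0 T)
  inequality : ∀ x, ∀ t ∈ Ioc 0 T, ∃ L : ℝ, HasFracLaplacianAt s (fun y => u y t) L x ∧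
    ρ x * derivWithin (u x) (Ioc 0 T) t - Laplacian.laplacian (fun y => u y t) x + L ≤ 0
  initial_nonpos : ∀ x, u x 0 ≤ 0

variable {N : ℕ} {s T : ℝ} {ρ : EuclideanSpace ℝ (Fin N) → ℝ}
  {u : EuclideanSpace ℝ (Fin N) → ℝ → ℝ} {p q κ ε C C₀ t : ℝ} {x : EuclideanSpace ℝ (Fin N)}

lemma IsSubsolution.exists_isMaxOn_sub_barrier (hu : IsSubsolution s T ρ u) (hqp : q < p)
    (hgrowth : ∀ y, ∀ r ∈ Ioc 0 T, u y r ≤ C * (1 + ‖y‖ ^ 2) ^ q) (hκ : 0 ≤ κ) (hε : 0 < ε)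
    (ht : t ∈ Ioc 0 T) (hpos : ε * barrier p κ x t < u x t) :
    ∃ x₀, ∃ t₀ ∈ Ioc 0 T, ∀ y, ∀ r ∈ Ioc 0 T,
      u y r - ε * barrier p κ y r ≤ u x₀ t₀ - ε * barrier p κ x₀ t₀ := by
  set w : EuclideanSpace ℝ (Fin N) × ℝ → ℝ := fun q => u q.1 q.2 - ε * barrier p κ q.1 q.2
  have hw : ContinuousOn w (univ ×ˢ Icc 0 T) :=
    hu.continuousOn.sub ((continuous_barrier p κ).const_mul ε).continuousOn
  have hw_initial : ∀ y, w (y, 0) ≤ 0 := fun y =>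
    sub_nonpos.2 ((hu.initial_nonpos y).trans (mul_pos hε (barrier_pos p κ y 0)).le)
  have hw_far : ∀ᶠ q in cocompact _ ⊓ 𝓟 (univ ×ˢ Icc 0 T), w q ≤ w (x, t) := by
    filter_upwards [(tendsto_fst_cocompact_inf_principal isCompact_Icc).eventually
      (eventually_growth_le_barrier C hqp hκ hε), mem_inf_of_right (mem_principal_self _)]
      with ⟨y, r⟩ hy ⟨_, hr⟩
    suffices w (y, r) ≤ 0 from this.trans (sub_pos.2 hpos).le
    rcases hr.1.eq_or_lt with rfl | hr₀
    · exact hw_initial y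
    · exact sub_nonpos.2 ((hgrowth y r ⟨hr₀, hr.2⟩).trans (hy r hr.1))
  obtain ⟨⟨x₀, t₀⟩, ⟨-, ht₀⟩, hmax⟩ := hw.exists_isMaxOn' (isClosed_univ.prod isClosed_Icc)
    (x₀ := (x, t)) ⟨mem_univ x, Ioc_subset_Icc_self ht⟩ hw_far
  have hw₀ : 0 < w (x₀, t₀) :=
    (sub_pos.2 hpos).trans_le (hmax (a := (x, t)) ⟨mem_univ x, Ioc_subset_Icc_self ht⟩)
  refine ⟨x₀, t₀, ⟨ht₀.1.lt_of_ne' ?_, ht₀.2⟩, fun y r hr =>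
    hmax (a := (y, r)) ⟨mem_univ y, Ioc_subset_Icc_self hr⟩⟩
  rintro rfl
  exact (hw_initial x₀).not_gt hw₀

lemma HasFracLaplacianAt.ge_of_forall_sub_barrier_le {f : EuclideanSpace ℝ (Fin N) → ℝ} {L : ℝ}
    (hL : HasFracLaplacianAt s f L x) (hN : 1 ≤ N) (hs₁ : s < 1) (hp₀ : 0 ≤ p) (hps : p < s)
    (hε : 0 ≤ ε) (hmax : ∀ y, f y - ε * barrier p κ y t ≤ f x - ε * barrier p κ x t) :
    -(ε * Real.exp (κ * t) * barrierConst N s p) ≤ L := by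
  have : Nonempty (Fin N) := ⟨⟨0, hN⟩⟩
  have hint := integrable_min_rpow_norm_div (E := EuclideanSpace ℝ (Fin N)) volume
    (a := 2) (b := 2 * p) (σ := 2 * s) (by linarith) (by linarith)
  rw [finrank_euclideanSpace_fin] at hint
  have hge := hL.ge_of_second_difference_le (hp₀.trans_lt hps) hs₁ (fun z => by positivity)
    (by simpa only [mul_div_assoc] using hint.const_mul (ε * Real.exp (κ * t)))
    (second_difference_le_of_forall_sub_barrier_le hp₀ (hps.le.trans hs₁.le) hε hmax)
  simp only [mul_div_assoc, integral_const_mul] at hge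
  rw [barrierConst]
  linarith

lemma laplacian_le_of_forall_sub_barrier_le {f : EuclideanSpace ℝ (Fin N) → ℝ}
    (hf : ContDiff ℝ 2 f) (hp₀ : 0 ≤ p) (hp₁ : p ≤ 1) (hε : 0 ≤ ε)
    (hmax : ∀ y, f y - ε * barrier p κ y t ≤ f x - ε * barrier p κ x t) :
    Laplacian.laplacian f x ≤ ε * Real.exp (κ * t) * (2 * N) := by
  refine (laplacian_le_of_second_difference_le (c := 2 * (ε * Real.exp (κ * t))) hf
    fun z => ?_).trans_eq (by rw [finrank_euclideanSpace_fin]; ring)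
  refine (second_difference_le_of_forall_sub_barrier_le hp₀ hp₁ hε hmax z).trans ?_
  rw [mul_assoc 2, ← Real.rpow_two]
  gcongr
  exact min_le_left _ _

lemma IsSubsolution.mul_le_of_forall_sub_barrier_le (hu : IsSubsolution s T ρ u) (hN : 1 ≤ N)
    (hs₁ : s < 1) (hp₀ : 0 ≤ p) (hps : p < s) (hC₀ : 0 ≤ C₀)
    (hρ : C₀ ≤ ρ x * (1 + ‖x‖ ^ 2) ^ p) (hκ : 0 ≤ κ) (hε : 0 < ε) (ht : t ∈ Ioc 0 T)
    (hmax : ∀ y, ∀ r ∈ Ioc 0 T, u y r - ε * barrier p κ y r ≤ u x t - ε * barrier p κ x t) :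
    C₀ * κ ≤ 2 * N + barrierConst N s p := by
  obtain ⟨L, hL, hineq⟩ := hu.inequality x t ht
  have hfrac := hL.ge_of_forall_sub_barrier_le hN hs₁ hp₀ hps hε.le fun y => hmax y t ht
  have hlap := laplacian_le_of_forall_sub_barrier_le (hu.contDiff_space t ht) hp₀
    (hps.le.trans hs₁.le) hε.le fun y => hmax y t ht
  have hpast : Ioc 0 T ∈ 𝓝[<] t := mem_of_superset (Ioo_mem_nhdsLT ht.1) fun r hr =>
    ⟨hr.1, hr.2.le.trans ht.2⟩
  have htime : ε * (κ * barrier p κ x t) ≤ derivWithin (u x) (Ioc 0 T) t :=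
    hasDerivWithinAt_Iio_le_of_eventually_sub_le
      ((hu.differentiableOn_time x t ht).hasDerivWithinAt.mono_of_mem_nhdsWithin hpast)
      ((hasDerivAt_barrier p κ x t).const_mul ε).hasDerivWithinAt
      (mem_of_superset hpast fun r hr => hmax x r hr)
  have hρ₀ : 0 ≤ ρ x := nonneg_of_mul_nonneg_left (hC₀.trans hρ) (by positivity)
  have hscaled : ε * Real.exp (κ * t) * (C₀ * κ)
      ≤ ε * Real.exp (κ * t) * (2 * N + barrierConst N s p) :=
    calc ε * Real.exp (κ * t) * (C₀ * κ)
        ≤ ε * Real.exp (κ * t) * (ρ x * (1 + ‖x‖ ^ 2) ^ p * κ) := by gcongr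
      _ = ρ x * (ε * (κ * barrier p κ x t)) := by rw [barrier]; ring
      _ ≤ ρ x * derivWithin (u x) (Ioc 0 T) t := by gcongr
      _ ≤ ε * Real.exp (κ * t) * (2 * N + barrierConst N s p) := by linarith
  exact le_of_mul_le_mul_left hscaled (by positivity)

theorem IsSubsolution.nonpos (hu : IsSubsolution s T ρ u) (hN : 1 ≤ N) (hs₁ : s < 1)
    (hp₀ : 0 ≤ p) (hps : p < s) (hC₀ : 0 < C₀) (hρ : ∀ y, C₀ ≤ ρ y * (1 + ‖y‖ ^ 2) ^ p)
    (hqp : q < p) (hgrowth : ∀ y, ∀ r ∈ Ioc 0 T, u y r ≤ C * (1 + ‖y‖ ^ 2) ^ q)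
    (ht : t ∈ Ioc 0 T) : u x t ≤ 0 := by
  set K := 2 * N + barrierConst N s p
  have hK : 0 ≤ K := add_nonneg (by positivity) (barrierConst_nonneg N p (hp₀.trans_lt hps) hs₁)
  obtain ⟨κ, hκ, hκK⟩ : ∃ κ, 0 ≤ κ ∧ K < C₀ * κ :=
    ⟨(K + 1) / C₀, by positivity, by rw [mul_div_cancel₀ _ hC₀.ne']; linarith⟩
  have hbound : ∀ ε > 0, u x t ≤ ε * barrier p κ x t := by
    intro ε hε
    by_contra! hpos
    obtain ⟨x₀, t₀, ht₀, hmax⟩ := hu.exists_isMaxOn_sub_barrier hqp hgrowth hκ hε ht hpos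
    exact (hu.mul_le_of_forall_sub_barrier_le hN hs₁ hp₀ hps hC₀.le (hρ x₀) hκ hε ht₀
      hmax).not_gt hκK
  have hlim : Tendsto (fun ε => ε * barrier p κ x t) (𝓝[>] 0) (𝓝 0) := by
    simpa using (tendsto_id.mono_left nhdsWithin_le_nhds).mul_const (barrier p κ x t) (a := 0)
  exact ge_of_tendsto hlim (eventually_mem_nhdsWithin.mono hbound)

end MaximumPrinciple

section Uniqueness

variable {N : ℕ} {s T : ℝ} {ρ : EuclideanSpace ℝ (Fin N) → ℝ}
  {u : EuclideanSpace ℝ (Fin N) → ℝ → ℝ}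

lemma IsSolutionEquation.neg (hu : IsSolutionEquation s T ρ u) :
    IsSolutionEquation s T ρ fun x t => -u x t where
  contDiffOn := hu.contDiffOn.neg
  memLs t ht := ⟨(hu.memLs t ht).1.neg, by simpa [lsNorm] using (hu.memLs t ht).2⟩
  equation x t ht := by
    obtain ⟨L, hL, h⟩ := hu.equation x t ht
    have htime : derivWithin (fun t => -u x t) (Ioc 0 T) t = -derivWithin (u x) (Ioc 0 T) t :=
      derivWithin.fun_neg
    have hlap : Laplacian.laplacian (fun y => -u y t) x = -Laplacian.laplacian (fun y => u y t) x :=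
      congrFun (InnerProductSpace.laplacian_neg (f := fun y => u y t)) x
    refine ⟨-L, hL.neg, ?_⟩
    rw [htime, hlap]
    linarith

lemma IsSolutionEquation.isSubsolution (hu : IsSolutionEquation s T ρ u)
    (hcont : ContinuousOn (Function.uncurry u) (univ ×ˢ Icc 0 T)) (hinit : ∀ x, u x 0 ≤ 0) :
    IsSubsolution s T ρ u where
  continuousOn := hcont
  contDiff_space t ht := contDiffOn_univ.1 <|
    hu.contDiffOn.comp (f := fun y => (y, t)) (by fun_prop) fun y _ => ⟨mem_univ y, ht⟩
  differentiableOn_time x :=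
    (hu.contDiffOn.comp (f := fun r => (x, r)) (by fun_prop)
      fun r hr => ⟨mem_univ x, hr⟩).differentiableOn two_ne_zero
  inequality x t ht := (hu.equation x t ht).imp fun _ h => ⟨h.1, h.2.le⟩
  initial_nonpos := hinit

lemma le_mul_rpow_of_mul_rpow_neg_le {E : Type*} [NormedAddCommGroup E] {r C₀ a p : ℝ} {x : E}
    (hC₀ : 0 ≤ C₀) (hap : a ≤ p) (h : C₀ * (1 + ‖x‖ ^ 2) ^ (-a) ≤ r) :
    C₀ ≤ r * (1 + ‖x‖ ^ 2) ^ p :=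
  calc C₀ ≤ C₀ * (1 + ‖x‖ ^ 2) ^ (-a + p) :=
        le_mul_of_one_le_right hC₀
          (Real.one_le_rpow (by linarith [sq_nonneg ‖x‖]) (by linarith))
    _ = C₀ * (1 + ‖x‖ ^ 2) ^ (-a) * (1 + ‖x‖ ^ 2) ^ p := by
        rw [Real.rpow_add (by positivity), mul_assoc]
    _ ≤ r * (1 + ‖x‖ ^ 2) ^ p := by gcongr

theorem corollary5p4_general (hN : 1 ≤ N) (hs₀ : 0 < s) (hs₁ : s < 1) {α C₀ : ℝ} (hα : α < 2 * s)
    (hC₀ : 0 < C₀) (hρ : ∀ x, C₀ * (1 + ‖x‖ ^ 2) ^ (-(α / 2)) ≤ ρ x)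
    (hu : IsSolutionEquation s T ρ u)
    (hcont : ContinuousOn (Function.uncurry u) (univ ×ˢ Icc 0 T)) (hinit : ∀ x, u x 0 = 0)
    {C θ : ℝ} (hθ : θ < 2 * s)
    (hgrowth : ∀ x, ∀ t ∈ Ioc 0 T, |u x t| ≤ C * (1 + ‖x‖ ^ 2) ^ (θ / 2)) :
    ∀ x, ∀ t ∈ Ioc 0 T, u x t = 0 := by
  intro x t ht
  obtain ⟨p, hp, hps⟩ : ∃ p, max 0 (max (α / 2) (θ / 2)) < p ∧ p < s :=
    exists_between (max_lt hs₀ (max_lt (by linarith) (by linarith)))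
  obtain ⟨hp₀, hαp, hθp⟩ : 0 < p ∧ α / 2 < p ∧ θ / 2 < p := by simpa only [max_lt_iff] using hp
  have hρp : ∀ y, C₀ ≤ ρ y * (1 + ‖y‖ ^ 2) ^ p := fun y =>
    le_mul_rpow_of_mul_rpow_neg_le hC₀.le hαp.le (hρ y)
  have hle : u x t ≤ 0 := (hu.isSubsolution hcont fun y => (hinit y).le).nonpos hN hs₁ hp₀.le hps
    hC₀ hρp hθp (fun y r hr => (le_abs_self _).trans (hgrowth y r hr)) ht
  have hge : -u x t ≤ 0 := (hu.neg.isSubsolution hcont.neg fun y => by simp [hinit y]).nonpos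
    hN hs₁ hp₀.le hps hC₀ hρp hθp (fun y r hr => (neg_le_abs _).trans (hgrowth y r hr)) ht
  linarith

end Uniqueness

theorem corollary5p4 (N : ℕ) (hN : 1 ≤ N) (s : ℝ) (hs₀ : 0 < s) (hs₁ : s < 1)
    (T : ℝ) (hT : 0 < T) (α : ℝ) (ρ : EuclideanSpace ℝ (Fin N) → ℝ)
    (hρ : AssumptionH0 ρ α) (hα : α < 2 * s)
    (u : EuclideanSpace ℝ (Fin N) → ℝ → ℝ) (hu : IsSolutionCauchyProblem s T ρ u)
    (C θ : ℝ) (hC : 0 < C) (hθ₀ : 0 ≤ θ) (hθ₁ : θ < 2 * s - α)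
    (hgrowth : ∀ x, ∀ t ∈ Set.Ioc 0 T, |u x t| ≤ C * (1 + ‖x‖ ^ 2) ^ (θ / 2)) :
    ∀ x, ∀ t ∈ Set.Ioc 0 T, u x t = 0 := by
  obtain ⟨C₀, hC₀, hρC₀⟩ := hρ.lower_bound
  exact corollary5p4_general hN hs₀ hs₁ hα hC₀ hρC₀ hu.solution hu.contDiffOn_closure.continuousOn
    hu.initial (by linarith [hρ.alpha_nonneg]) hgrowth
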